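/- Let $\mathcal X$ be a non-empty set, let $\Sigma$ be a $\sigma$-algebra on $\mathcal Z=\mathcal X\times\{0,1\}$ containing all finite subsets of $\mathcal Z$, let $\mathcal D$ be a set of probability measures on $(\mathcal Z,\Sigma)$, and let $\emptyset\ne\mathcal H\subseteq\{0,1\}^{\mathcal X}$. Write $\mathbb N=\{1,2,\dots\}$. For $h\in\mathcal H$ let $\Gamma(h)=\{(x,y)\in\mathcal Z: h(x)=y\}$. For $D\in\mathcal D$, $m\in\mathbb N$ and $z=(z_1,\dots,z_m)\in\mathcal Z^m$ put $$\mathrm{er}_D(h)=D(\mathcal Z\setminus\Gamma(h)),\quad \mathrm{opt}_D(\mathcal H)=\inf_{h\in\mathcal H}\mathrm{er}_D(h),\quad \hat{\mathrm{er}}_z(h)=\frac1m\sum_{i=1}^m\mathbf 1_{\mathcal Z\setminus\Gamma(h)}(z_i),\quad \hat{\mathrm{opt}}_z(\mathcal H)=\inf_{h\in\mathcal H}\hat{\mathrm{er}}_z(h).$$ Let $D^m$ be the $m$-fold product measure on the product $\sigma$-algebra $\Sigma^m$ of $\mathcal Z^m$, and set $$U_{m,D}(z)=\sup_{h\in\mathcal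 H}|\mathrm{er}_D(h)-\hat{\mathrm{er}}_z(h)|\ (z\in\mathcal Z^m),\qquad V_m(z,z')=\sup_{h\in\mathcal H}|\hat{\mathrm{er}}_{z'}(h)-\hat{\mathrm{er}}_z(h)|\ (z,z'\in\mathcal Z^m).$$ Assume that $\mathcal D$ contains all discrete uniform distributions, i.e. all probability measures $\sum_{j=1}^{\ell}\frac1\ell\delta_{\omega_j}$ with $\ell\in\mathbb N$ and $\omega_1,\dots,\omega_\ell\in\mathcal Z$. Assume further that $\mathcal H$ is well-behaved with respect to $\mathcal D$: $\Gamma(h)\in\Sigma$ for every $h\in\mathcal H$, and there is $m_{\mathcal H}\in\mathbb N$ such that for all $m\ge m_{\mathcal H}$ the map $V_m$ is $\Sigma^{2m}$-measurable and, for all $D\in\mathcal D$, the map $U_{m,D}$ is $\Sigma^m$-measurable. A learning function for $\mathcal H$ is any map $\mathcal A:\bigcup_{m\in\mathbb N}\mathcal Z^m\to\mathcal H$. It is *NMSE* (nearly minimizing the sample error) if for every $\varepsilon\in(0,1)$ there is $m_0\in\mathbb N$ such that $\hat{\mathrm{er}}_z(\mathcal A(z))-\hat{\mathrm{opt}}_z(\mathcal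 H)\le\varepsilon$ for all $m\ge m_0$ and all $z\in\mathcal Z^m$. It is *PAC* (with respect to $\mathcal D$) if for all $\varepsilon,\delta\in(0,1)$ there is $m_0\in\mathbb N$ such that for all $m\ge m_0$ and all $D\in\mathcal D$ there is $C\in\Sigma^m$ with $C\subseteq\{z\in\mathcal Z^m:\mathrm{er}_D(\mathcal A(z))-\mathrm{opt}_D(\mathcal H)\le\varepsilon\}$ and $D^m(C)\ge1-\delta$. The VC dimension $\mathrm{vc}(\mathcal H)\in\{0,1,2,\dots\}\cup\{\infty\}$ is the supremum of the sizes of the finite sets $A\subseteq\mathcal X$ with $\{h|_A:h\in\mathcal H\}=\{0,1\}^A$. Then the following are equivalent: 1. $\mathrm{vc}(\mathcal H)<\infty$. 2. $\mathcal H$ has the uniform convergence property with respect to $\mathcal D$: there is $m_{\mathcal H}\in\mathbb N$ such that $U_{m,D}$ is $\Sigma^m$-measurable for all $m\ge m_{\mathcal H}$ and $D\in\mathcal D$, and for all $\varepsilon,\delta\in(0,1)$ there is $m_0\ge m_{\mathcal H}$ such that $D^m(\{z\in\mathcal Z^m: U_{m,D}(z)\le\varepsilon\})\ge1-\delta$ for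 all $m\ge m_0$ and all $D\in\mathcal D$. 3. Every learning function for $\mathcal H$ that is NMSE is PAC with respect to $\mathcal D$. 4. $\mathcal H$ is (agnostically) PAC learnable with respect to $\mathcal D$, i.e. some learning function for $\mathcal H$ is PAC with respect to $\mathcal D$. In particular, $\mathcal H$ is PAC learnable with respect to $\mathcal D$ if and only if $\mathrm{vc}(\mathcal H)<\infty$. -/

import Mathlib

open MeasureTheory
open scoped ENNReal

noncomputable section

namespace StatLearning

section General

variable {Ω : Type*} [MeasurableSpace Ω]

/-- A discrete uniform distribution: a probability measure of the form
`∑ j, (1/ℓ) δ_{ω_j}` with `ℓ ≥ 1`; the points `ω_j` need not be distinct. -/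
def IsDiscreteUniform (P : ProbabilityMeasure Ω) : Prop :=
  ∃ (l : ℕ+) (ω : Fin l → Ω),
    (P : Measure Ω) = ∑ j, (1 / ((l : ℕ) : ℝ≥0∞)) • Measure.dirac (ω j)

end General

variable {X : Type*}

/-- The graph of a hypothesis, as a subset of the sample space `X × {0,1}`. -/
def graph (h : X → Bool) : Set (X × Bool) := {z | h z.1 = z.2}

/-- The zero-one loss: the indicator of the complement of the graph. -/
def loss (h : X → Bool) (z : X × Bool) : ℝ := (graph h)ᶜ.indicator (fun _ => 1) z

/-- The sample error of `h` on a multi-sample of length `m`. -/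
def sampleErr {m : ℕ} (z : Fin m → X × Bool) (h : X → Bool) : ℝ :=
  (1 / (m : ℝ)) * ∑ i, loss h (z i)

/-- The minimal sample error of a hypothesis space on a multi-sample. -/
def sampleOpt {m : ℕ} (z : Fin m → X × Bool) (H : Set (X → Bool)) : ℝ :=
  ⨅ h : H, sampleErr z h

/-- A hypothesis space shatters `A` if its restriction to `A` is all of `{0,1}^A`. -/
def Shatters (H : Set (X → Bool)) (A : Set X) : Prop :=
  (fun h : X → Bool => A.domRestrict h) '' H = Set.univ

/-- The VC dimension: the supremum in `ℕ ∪ {∞}` of the sizes of the finite shattered sets. -/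
def vcDim (H : Set (X → Bool)) : ℕ∞ :=
  sSup {d : ℕ∞ | ∃ A : Finset X, (A.card : ℕ∞) = d ∧ Shatters H (A : Set X)}

/-- A learning function for `H`: any map from multi-samples of positive length to `H`. -/
abbrev LearningFunction (H : Set (X → Bool)) : Type _ :=
  (Σ m : ℕ+, (Fin m → X × Bool)) → H

/-- Nearly minimizing the sample error. -/
def IsNMSE {H : Set (X → Bool)} (A : LearningFunction H) : Prop :=
  ∀ ε ∈ Set.Ioo (0 : ℝ) 1, ∃ m₀ : ℕ+, ∀ m : ℕ+, m₀ ≤ m → ∀ z : Fin m → X × Bool,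
    sampleErr z (A ⟨m, z⟩ : X → Bool) - sampleOpt z H ≤ ε

/-- The map `V(H, m)`, on `Z^m × Z^m` (that is, `Z^{2m}`). -/
def devV (H : Set (X → Bool)) (m : ℕ)
    (p : (Fin m → X × Bool) × (Fin m → X × Bool)) : ℝ :=
  ⨆ h : H, |sampleErr p.2 h - sampleErr p.1 h|

variable [MeasurableSpace (X × Bool)]

/-- The true error of `h`: the probability of misclassification. -/
def trueErr (D : ProbabilityMeasure (X × Bool)) (h : X → Bool) : ℝ :=
  (D : Measure (X × Bool)).real (graph h)ᶜ

/-- The approximation error of `H`. -/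
def trueOpt (D : ProbabilityMeasure (X × Bool)) (H : Set (X → Bool)) : ℝ :=
  ⨅ h : H, trueErr D h

/-- The law of `m` independent samples drawn from `D`, on the product σ-algebra. -/
def sampleLaw (D : ProbabilityMeasure (X × Bool)) (m : ℕ) : Measure (Fin m → X × Bool) :=
  Measure.pi fun _ => (D : Measure (X × Bool))

/-- The map `U(H, m, D)`. -/
def devU (H : Set (X → Bool)) (m : ℕ) (D : ProbabilityMeasure (X × Bool))
    (z : Fin m → X × Bool) : ℝ :=
  ⨆ h : H, |trueErr D h - sampleErr z h|

/-- The hypothesis space `H` is well-behaved with respect to `𝒟`. -/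
def WellBehaved (𝒟 : Set (ProbabilityMeasure (X × Bool))) (H : Set (X → Bool)) : Prop :=
  (∀ h ∈ H, MeasurableSet (graph h)) ∧
  ∃ mH : ℕ+,
    (∀ m : ℕ+, mH ≤ m → Measurable (devV H m)) ∧
    (∀ m : ℕ+, mH ≤ m → ∀ D ∈ 𝒟, Measurable (devU H m D))

/-- The uniform convergence property of `H` with respect to `𝒟`; it includes the requirement
that the maps `U(H, m, D)` are measurable for large `m`. -/
def HasUCP (𝒟 : Set (ProbabilityMeasure (X × Bool))) (H : Set (X → Bool)) : Prop :=
  ∃ mH : ℕ+,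
    (∀ m : ℕ+, mH ≤ m → ∀ D ∈ 𝒟, Measurable (devU H m D)) ∧
    ∀ ε ∈ Set.Ioo (0 : ℝ) 1, ∀ δ ∈ Set.Ioo (0 : ℝ) 1, ∃ m₀ : ℕ+, mH ≤ m₀ ∧
      ∀ m : ℕ+, m₀ ≤ m → ∀ D ∈ 𝒟,
        1 - δ ≤ (sampleLaw D m).real {z | devU H m D z ≤ ε}

/-- A learning function is probably approximately correct with respect to `𝒟`. -/
def IsPAC (𝒟 : Set (ProbabilityMeasure (X × Bool))) {H : Set (X → Bool)}
    (A : LearningFunction H) : Prop :=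
  ∀ ε ∈ Set.Ioo (0 : ℝ) 1, ∀ δ ∈ Set.Ioo (0 : ℝ) 1, ∃ m₀ : ℕ+,
    ∀ m : ℕ+, m₀ ≤ m → ∀ D ∈ 𝒟, ∃ C : Set (Fin m → X × Bool), MeasurableSet C ∧
      C ⊆ {z | trueErr D (A ⟨m, z⟩ : X → Bool) - trueOpt D H ≤ ε} ∧
      1 - δ ≤ (sampleLaw D m).real C

/-- (Agnostic) PAC learnability of `H` with respect to `𝒟`. -/
def PACLearnable (𝒟 : Set (ProbabilityMeasure (X × Bool))) (H : Set (X → Bool)) : Prop :=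
  ∃ A : LearningFunction H, IsPAC 𝒟 A

end StatLearning

end

open MeasureTheory
open scoped ENNReal

noncomputable section

/-! The conditions are linked in the cycle 1 → 2 → 3 → 4 → 1.

Finite VC dimension yields uniform convergence by symmetrization. The true error is the mean sample
error on an independent second sample, so the mean of U is at most the mean of V
(`devU_le_integral_devV`). Exchanging corresponding entries of the two samples preserves their joint
law, so V may be averaged over random signs with both samples held fixed. Then only the traces of
`H` on the at most 2m sampled points matter: Sauer–Shelah bounds their number polynomially in m, and
Massart's lemma bounds the average (`sum_devV_swapBy_le`). Markov's inequality turns the bound on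
the mean into one in probability.

Under uniform convergence sample errors are faithful to true errors, so near-minimizers of the
sample error are PAC; such learners always exist.

If the VC dimension is infinite, take 2m shattered points with random labels for samples of size m.
A learner sees at most half of the labels and errs on each unseen one half of the time, so its mean
error is at least 1/4. Every labelling is realized in `H`, so a PAC learner would have mean error at
most 1/5. -/

namespace StatLearning

/-! ### Shattering and the Sauer–Shelah bound -/

section Combinatorics

variable {X : Type*}

lemma shatters_iff {H : Set (X → Bool)} {A : Set X} :
    Shatters H A ↔ ∀ f : A → Bool, ∃ h ∈ H, ∀ a : A, h a = f a := by
  simp only [Shatters, Set.eq_univ_iff_forall, Set.mem_image, funext_iff, Set.domRestrict_apply]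

lemma card_le_of_shatters {H : Set (X → Bool)} {d : ℕ} (hd : vcDim H = d) {A : Finset X}
    (hA : Shatters H (A : Set X)) : A.card ≤ d := by
  have h : (A.card : ℕ∞) ≤ vcDim H := le_sSup ⟨A, rfl, hA⟩
  rw [hd] at h
  exact_mod_cast h

/-- A hypothesis space of infinite VC dimension realizes all labellings of some
family of `n` points, for every `n`. -/
lemma exists_shattered_family {H : Set (X → Bool)} (hH : vcDim H = ⊤) (n : ℕ) :
    ∃ x : Fin n → X, ∀ b : Fin n → Bool, ∃ h ∈ H, ∀ j, h (x j) = b j := by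
  have hlt : (n : ℕ∞) < vcDim H := hH ▸ ENat.natCast_lt_top n
  obtain ⟨_, ⟨A, rfl, hA⟩, hn⟩ := lt_sSup_iff.1 hlt
  have hn' : n ≤ A.card := le_of_lt (by exact_mod_cast hn)
  have e : Fin n ↪ A := (Fin.castLEEmb hn').trans A.equivFin.symm.toEmbedding
  refine ⟨fun j => e j, fun b => ?_⟩
  obtain ⟨h, hh, hb⟩ := shatters_iff.1 hA fun a => Function.extend e b (fun _ => true) a
  exact ⟨h, hh, fun j => (hb (e j)).trans (e.injective.extend_apply _ _ _)⟩

lemma card_filter_card_le_powerset (A : Finset X) (d : ℕ) :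
    (A.powerset.filter fun s => s.card ≤ d).card ≤ (d + 1) * (A.card + 1) ^ d := by
  classical
  have hsub : (A.powerset.filter fun s => s.card ≤ d) ⊆
      (Finset.range (d + 1)).biUnion fun k => A.powersetCard k := by
    intro s hs
    simp only [Finset.mem_filter, Finset.mem_powerset] at hs
    simp only [Finset.mem_biUnion, Finset.mem_range, Finset.mem_powersetCard]
    exact ⟨s.card, by omega, hs.1, rfl⟩
  refine (Finset.card_le_card hsub).trans ?_
  have := Finset.card_biUnion_le_card_mul (Finset.range (d + 1)) (fun k => A.powersetCard k)
    ((A.card + 1) ^ d) fun k hk => by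
      rw [Finset.card_powersetCard]
      calc A.card.choose k ≤ A.card ^ k := Nat.choose_le_pow _ _
        _ ≤ (A.card + 1) ^ k := Nat.pow_le_pow_left (Nat.le_succ _) _
        _ ≤ (A.card + 1) ^ d :=
          Nat.pow_le_pow_right (Nat.succ_pos _) (by simpa [Nat.lt_succ_iff] using hk)
  simpa using this

/-- **Sauer–Shelah**: a bounded VC dimension bounds the number of traces polynomially. -/
lemma card_traces_le {H : Set (X → Bool)} {d : ℕ} (hd : vcDim H = d) (A : Finset X)
    (T : Finset (Finset X)) (hT : ∀ t ∈ T, ∃ h ∈ H, t = A.filter fun x => h x = true) :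
    T.card ≤ (d + 1) * (A.card + 1) ^ d := by
  classical
  refine T.card_le_card_shatterer.trans (le_trans (Finset.card_le_card fun s hs => ?_)
    (card_filter_card_le_powerset A d))
  rw [Finset.mem_shatterer] at hs
  -- Shattering `s` puts `s` inside some trace, and traces lie in `A`.
  have hsA : s ⊆ A := by
    obtain ⟨t, ht, hst⟩ := hs.exists_superset
    obtain ⟨h, -, rfl⟩ := hT t ht
    exact hst.trans (Finset.filter_subset _ _)
  rw [Finset.mem_filter, Finset.mem_powerset]
  refine ⟨hsA, card_le_of_shatters hd (shatters_iff.2 fun f => ?_)⟩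
  obtain ⟨u, hu, hsu⟩ := hs (t := s.filter fun x => ∃ hx : x ∈ s, f ⟨x, hx⟩ = true)
    (Finset.filter_subset _ _)
  obtain ⟨h, hh, rfl⟩ := hT u hu
  refine ⟨h, hh, fun ⟨a, ha⟩ => ?_⟩
  have ha' : a ∈ s := ha
  have := congrArg (a ∈ ·) hsu
  simp only [Finset.mem_inter, Finset.mem_filter, ha', hsA ha', true_and, exists_true_left,
    eq_iff_iff] at this
  exact Bool.eq_iff_iff.2 this

end Combinatorics

/-! ### Random signs and Massart's lemma -/

section Rademacher

variable {ι : Type*} [Fintype ι]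

/-- The sign attached to a boolean. -/
def sign (b : Bool) : ℝ := if b then 1 else -1

/-- Independence of the signs factors the sum over coordinates; each factor is 2 cosh(t a i), and
cosh x ≤ exp(x²/2). -/
lemma sum_exp_sign_le [DecidableEq ι] (a : ι → ℝ) (ha : ∀ i, |a i| ≤ 1) (t : ℝ) :
    ∑ σ : ι → Bool, Real.exp (t * ∑ i, sign (σ i) * a i) ≤
      2 ^ Fintype.card ι * Real.exp (t ^ 2 / 2 * Fintype.card ι) := by
  have h1 : ∀ σ : ι → Bool, Real.exp (t * ∑ i, sign (σ i) * a i) =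
      ∏ i, Real.exp (t * (sign (σ i) * a i)) := fun σ => by
    rw [Finset.mul_sum, Real.exp_sum]
  simp_rw [h1]
  have h2 := Finset.prod_univ_sum (fun _ : ι => (Finset.univ : Finset Bool))
    (fun i b => Real.exp (t * (sign b * a i)))
  rw [Fintype.piFinset_univ] at h2
  rw [← h2]
  have h3 : ∀ i, ∑ b : Bool, Real.exp (t * (sign b * a i)) ≤ 2 * Real.exp (t ^ 2 / 2) := by
    intro i
    have hc := Real.cosh_le_exp_half_sq (t * a i)
    have hm : Real.exp ((t * a i) ^ 2 / 2) ≤ Real.exp (t ^ 2 / 2) := by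
      have : a i ^ 2 ≤ 1 := (sq_le_one_iff_abs_le_one _).2 (ha i)
      rw [Real.exp_le_exp, mul_pow]
      nlinarith [sq_nonneg t]
    rw [Real.cosh_eq] at hc
    simp only [Fintype.sum_bool, sign, if_true, Bool.false_eq_true, if_false, one_mul, neg_mul,
      mul_neg]
    linarith
  calc ∏ i, ∑ b : Bool, Real.exp (t * (sign b * a i))
      ≤ ∏ _i : ι, 2 * Real.exp (t ^ 2 / 2) :=
        Finset.prod_le_prod (fun i _ => Finset.sum_nonneg fun _ _ => (Real.exp_pos _).le)
          fun i _ => h3 i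
    _ = 2 ^ Fintype.card ι * Real.exp (t ^ 2 / 2 * Fintype.card ι) := by
        rw [Finset.prod_const, Finset.card_univ, mul_pow, ← Real.exp_nat_mul, mul_comm (t ^ 2 / 2)]

/-- **Finite class lemma** (Massart): `M σ` is at most the largest absolute signed sum over the
finite class `T`. -/
lemma sum_le_of_forall_abs_signed_sum_le [DecidableEq ι] (T : Finset (ι → ℝ))
    (hT : ∀ a ∈ T, ∀ i, |a i| ≤ 1) {N : ℝ} (hN : 0 < N) (hTN : (T.card : ℝ) ≤ N)
    (M : (ι → Bool) → ℝ)
    (hM : ∀ σ B, (∀ a ∈ T, |∑ i, sign (σ i) * a i| ≤ B) → M σ ≤ B) {t : ℝ} (ht : 0 < t) :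
    ∑ σ, M σ ≤ 2 ^ Fintype.card ι *
      ((Real.log (2 * N) + t ^ 2 / 2 * Fintype.card ι + 1) / t) := by
  -- With this choice, exp(-c) scales the sign average of the total of `E` over `T` to at most 1.
  set c := Real.log (2 * N) + t ^ 2 / 2 * Fintype.card ι with hc
  set E : (ι → ℝ) → (ι → Bool) → ℝ := fun a σ =>
    Real.exp (t * ∑ i, sign (σ i) * a i) + Real.exp (-t * ∑ i, sign (σ i) * a i) with hE
  have hEpos : ∀ a σ, 0 ≤ E a σ := fun a σ => by positivity
  have key : ∀ σ, M σ ≤ (c + Real.exp (-c) * ∑ a ∈ T, E a σ) / t := by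
    intro σ
    refine hM σ _ fun a ha => ?_
    rw [le_div_iff₀ ht]
    set S := ∑ i, sign (σ i) * a i with hS
    have h1 : Real.exp (|S| * t) ≤ E a σ := by
      simp only [hE, ← hS]
      rcases abs_cases S with ⟨h, -⟩ | ⟨h, -⟩ <;> rw [h]
      · rw [mul_comm]; linarith [Real.exp_pos (-t * S)]
      · rw [neg_mul_comm, mul_comm]; linarith [Real.exp_pos (t * S)]
    have h2 : E a σ ≤ ∑ a ∈ T, E a σ :=
      Finset.single_le_sum (f := fun a => E a σ) (fun a _ => hEpos a σ) ha
    -- The tangent line of exp at 0 replaces Jensen's inequality for the logarithm.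
    have h3 := Real.add_one_le_exp (|S| * t - c)
    have h4 : Real.exp (|S| * t - c) = Real.exp (-c) * Real.exp (|S| * t) := by
      rw [← Real.exp_add]; ring_nf
    have h5 : Real.exp (-c) * Real.exp (|S| * t) ≤ Real.exp (-c) * ∑ a ∈ T, E a σ := by
      gcongr; exact h1.trans h2
    linarith
  set K : ℝ := 2 ^ Fintype.card ι with hK
  have hsumE : ∑ σ : ι → Bool, ∑ a ∈ T, E a σ ≤
      N * (2 * (K * Real.exp (t ^ 2 / 2 * Fintype.card ι))) := by
    rw [Finset.sum_comm]
    calc ∑ a ∈ T, ∑ σ, E a σ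
        ≤ ∑ a ∈ T, 2 * (K * Real.exp (t ^ 2 / 2 * Fintype.card ι)) := by
          refine Finset.sum_le_sum fun a ha => ?_
          rw [hE, Finset.sum_add_distrib, two_mul]
          have h1 := sum_exp_sign_le a (hT a ha) t
          have h2 := sum_exp_sign_le a (hT a ha) (-t)
          rw [neg_sq] at h2
          exact add_le_add h1 h2
      _ = T.card * (2 * (K * Real.exp (t ^ 2 / 2 * Fintype.card ι))) := by
          rw [Finset.sum_const, nsmul_eq_mul]
      _ ≤ _ := by gcongr
  have hexp : Real.exp (-c) * (N * (2 * (K * Real.exp (t ^ 2 / 2 * Fintype.card ι)))) = K := by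
    have : Real.exp c = 2 * N * Real.exp (t ^ 2 / 2 * Fintype.card ι) := by
      rw [hc, Real.exp_add, Real.exp_log (by positivity)]
    have h0 : Real.exp (-c) * Real.exp c = 1 := by rw [← Real.exp_add]; simp
    rw [this] at h0
    linear_combination K * h0
  have hcard : (Fintype.card (ι → Bool) : ℝ) = K := by simp [hK]
  calc ∑ σ, M σ ≤ ∑ σ : ι → Bool, (c + Real.exp (-c) * ∑ a ∈ T, E a σ) / t :=
        Finset.sum_le_sum fun σ _ => key σ
    _ = (K * c + Real.exp (-c) * ∑ σ : ι → Bool, ∑ a ∈ T, E a σ) / t := by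
        rw [← Finset.sum_div, Finset.sum_add_distrib, ← Finset.mul_sum, Finset.sum_const,
          nsmul_eq_mul, Finset.card_univ, hcard]
    _ ≤ (K * c + K) / t := by
        gcongr
        calc _ ≤ Real.exp (-c) * (N * (2 * (K * Real.exp (t ^ 2 / 2 * Fintype.card ι)))) := by
              gcongr
          _ = K := hexp
    _ = K * ((c + 1) / t) := by ring

end Rademacher

/-! ### Bounds and integrals of true and sample errors -/

section Errors

variable {X : Type*}

lemma loss_eq_ite (h : X → Bool) (z : X × Bool) :
    loss h z = if h z.1 = z.2 then 0 else 1 := by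
  by_cases hz : h z.1 = z.2 <;> simp [loss, graph, hz]

lemma loss_nonneg (h : X → Bool) (z : X × Bool) : 0 ≤ loss h z := by
  rw [loss_eq_ite]; split_ifs <;> norm_num

lemma loss_le_one (h : X → Bool) (z : X × Bool) : loss h z ≤ 1 := by
  rw [loss_eq_ite]; split_ifs <;> norm_num

variable {m : ℕ}

lemma sampleErr_nonneg (z : Fin m → X × Bool) (h : X → Bool) : 0 ≤ sampleErr z h :=
  mul_nonneg (by positivity) (Finset.sum_nonneg fun _ _ => loss_nonneg _ _)

lemma sampleErr_le_one (z : Fin m → X × Bool) (h : X → Bool) : sampleErr z h ≤ 1 := by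
  have h1 : ∑ i, loss h (z i) ≤ m := by
    simpa using Finset.sum_le_sum fun i (_ : i ∈ Finset.univ) => loss_le_one h (z i)
  rw [sampleErr, one_div_mul_eq_div]
  exact div_le_one_of_le₀ h1 (Nat.cast_nonneg _)

lemma abs_sampleErr_sub_le_one (z z' : Fin m → X × Bool) (h : X → Bool) :
    |sampleErr z' h - sampleErr z h| ≤ 1 := by
  rw [abs_le]
  constructor <;> linarith [sampleErr_nonneg z h, sampleErr_le_one z h, sampleErr_nonneg z' h,
    sampleErr_le_one z' h]

lemma le_devV {H : Set (X → Bool)} (p : (Fin m → X × Bool) × (Fin m → X × Bool)) (h : H) :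
    |sampleErr p.2 h - sampleErr p.1 h| ≤ devV H m p :=
  le_ciSup (f := fun h : H => |sampleErr p.2 h - sampleErr p.1 h|)
    ⟨1, by rintro _ ⟨h, rfl⟩; exact abs_sampleErr_sub_le_one _ _ _⟩ h

lemma devV_nonneg (H : Set (X → Bool)) (p : (Fin m → X × Bool) × (Fin m → X × Bool)) :
    0 ≤ devV H m p :=
  Real.iSup_nonneg fun _ => abs_nonneg _

lemma devV_le_one (H : Set (X → Bool)) (p : (Fin m → X × Bool) × (Fin m → X × Bool)) :
    devV H m p ≤ 1 :=
  Real.iSup_le (fun _ => abs_sampleErr_sub_le_one _ _ _) zero_le_one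

lemma sampleOpt_le (z : Fin m → X × Bool) {H : Set (X → Bool)} {h : X → Bool}
    (hh : h ∈ H) : sampleOpt z H ≤ sampleErr z h :=
  ciInf_le (f := fun h : H => sampleErr z h)
    ⟨0, by rintro _ ⟨h, rfl⟩; exact sampleErr_nonneg _ _⟩ ⟨h, hh⟩

variable [MeasurableSpace (X × Bool)]

lemma trueErr_nonneg (D : ProbabilityMeasure (X × Bool)) (h : X → Bool) : 0 ≤ trueErr D h :=
  measureReal_nonneg

lemma trueErr_le_one (D : ProbabilityMeasure (X × Bool)) (h : X → Bool) : trueErr D h ≤ 1 :=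
  measureReal_le_one

lemma trueOpt_le (D : ProbabilityMeasure (X × Bool)) {H : Set (X → Bool)} {h : X → Bool}
    (hh : h ∈ H) : trueOpt D H ≤ trueErr D h :=
  ciInf_le (f := fun h : H => trueErr D h)
    ⟨0, by rintro _ ⟨h, rfl⟩; exact trueErr_nonneg _ _⟩ ⟨h, hh⟩

lemma abs_trueErr_sub_sampleErr_le_one (D : ProbabilityMeasure (X × Bool))
    (z : Fin m → X × Bool) (h : X → Bool) : |trueErr D h - sampleErr z h| ≤ 1 := by
  rw [abs_le]
  constructor <;> linarith [sampleErr_nonneg z h, sampleErr_le_one z h, trueErr_nonneg D h,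
    trueErr_le_one D h]

lemma le_devU (D : ProbabilityMeasure (X × Bool)) {H : Set (X → Bool)} (z : Fin m → X × Bool)
    {h : X → Bool} (hh : h ∈ H) : |trueErr D h - sampleErr z h| ≤ devU H m D z :=
  le_ciSup (f := fun h : H => |trueErr D h - sampleErr z h|)
    ⟨1, by rintro _ ⟨h, rfl⟩; exact abs_trueErr_sub_sampleErr_le_one D z h⟩ ⟨h, hh⟩

lemma devU_le_one (D : ProbabilityMeasure (X × Bool)) (H : Set (X → Bool))
    (z : Fin m → X × Bool) : devU H m D z ≤ 1 :=
  Real.iSup_le (fun h => abs_trueErr_sub_sampleErr_le_one D z h) zero_le_one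

lemma devU_nonneg (D : ProbabilityMeasure (X × Bool)) (H : Set (X → Bool))
    (z : Fin m → X × Bool) : 0 ≤ devU H m D z :=
  Real.iSup_nonneg fun _ => abs_nonneg _

instance (D : ProbabilityMeasure (X × Bool)) : IsProbabilityMeasure (sampleLaw D m) :=
  inferInstanceAs (IsProbabilityMeasure (Measure.pi fun _ => (D : Measure (X × Bool))))

lemma measurable_loss {h : X → Bool} (hh : MeasurableSet (graph h)) : Measurable (loss h) :=
  measurable_const.indicator hh.compl

lemma integrable_loss (D : ProbabilityMeasure (X × Bool)) {h : X → Bool}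
    (hh : MeasurableSet (graph h)) : Integrable (loss h) (D : Measure (X × Bool)) :=
  (integrable_const (1 : ℝ)).indicator hh.compl

lemma integral_loss (D : ProbabilityMeasure (X × Bool)) {h : X → Bool}
    (hh : MeasurableSet (graph h)) : ∫ z, loss h z ∂(D : Measure (X × Bool)) = trueErr D h :=
  integral_indicator_one hh.compl

lemma integrable_loss_comp_eval (D : ProbabilityMeasure (X × Bool)) {h : X → Bool}
    (hh : MeasurableSet (graph h)) (i : Fin m) :
    Integrable (fun z : Fin m → X × Bool => loss h (z i)) (sampleLaw D m) :=
  integrable_comp_eval (μ := fun _ : Fin m => (D : Measure (X × Bool))) (integrable_loss D hh)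

lemma integrable_sampleErr (D : ProbabilityMeasure (X × Bool)) {h : X → Bool}
    (hh : MeasurableSet (graph h)) :
    Integrable (fun z : Fin m → X × Bool => sampleErr z h) (sampleLaw D m) :=
  (integrable_finsetSum _ fun i _ => integrable_loss_comp_eval D hh i).const_mul _

lemma integral_sampleErr (D : ProbabilityMeasure (X × Bool)) {h : X → Bool}
    (hh : MeasurableSet (graph h)) (hm : 0 < m) :
    ∫ z : Fin m → X × Bool, sampleErr z h ∂(sampleLaw D m) = trueErr D h := by
  have hi : ∀ i : Fin m, ∫ z : Fin m → X × Bool, loss h (z i) ∂(sampleLaw D m) = trueErr D h :=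
    fun i => (integral_comp_eval (μ := fun _ : Fin m => (D : Measure (X × Bool)))
      (measurable_loss hh).aestronglyMeasurable).trans (integral_loss D hh)
  have hm' : (m : ℝ) ≠ 0 := by positivity
  simp only [sampleErr]
  rw [integral_const_mul, integral_finsetSum _ fun i _ => integrable_loss_comp_eval D hh i]
  simp [hi, hm']

end Errors

/-! ### Symmetrization and uniform convergence -/

section Symmetrization

/-- Exchange the `i`-th entries of two samples whenever `σ i` is false. -/
def swapBy {ι Z : Type*} (σ : ι → Bool) (p : (ι → Z) × (ι → Z)) : (ι → Z) × (ι → Z) :=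
  (fun i => if σ i then p.1 i else p.2 i, fun i => if σ i then p.2 i else p.1 i)

/-- Regrouped as a family of pairs, the two samples have a product law with factors μ × μ, each
invariant under swapping its pair. -/
lemma measurePreserving_swapBy {ι Z : Type*} [Fintype ι] [MeasurableSpace Z] (μ : Measure Z)
    [SigmaFinite μ] (σ : ι → Bool) :
    MeasurePreserving (swapBy σ)
      ((Measure.pi fun _ : ι => μ).prod (Measure.pi fun _ : ι => μ))
      ((Measure.pi fun _ : ι => μ).prod (Measure.pi fun _ : ι => μ)) := by
  have h1 := measurePreserving_arrowProdEquivProdArrow Z Z ι (fun _ => μ) (fun _ => μ)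
  have h2 : MeasurePreserving
      (fun (a : ι → Z × Z) i => (if σ i then id else Prod.swap : Z × Z → Z × Z) (a i))
      (Measure.pi fun _ : ι => μ.prod μ) (Measure.pi fun _ : ι => μ.prod μ) := by
    refine measurePreserving_pi _ _ fun i => ?_
    split_ifs
    · exact MeasurePreserving.id _
    · exact Measure.measurePreserving_swap
  convert h1.comp (h2.comp h1.symm) using 1
  funext p
  refine Prod.ext (funext fun i => ?_) (funext fun i => ?_) <;>
    by_cases hi : σ i = true <;>
    simp [swapBy, hi, MeasurableEquiv.arrowProdEquivProdArrow, Equiv.arrowProdEquivProdArrow]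

variable {X : Type*} {m : ℕ}

lemma sampleErr_swapBy_sub (σ : Fin m → Bool) (p : (Fin m → X × Bool) × (Fin m → X × Bool))
    (h : X → Bool) :
    sampleErr (swapBy σ p).2 h - sampleErr (swapBy σ p).1 h =
      1 / (m : ℝ) * ∑ i, sign (σ i) * (loss h (p.2 i) - loss h (p.1 i)) := by
  simp only [sampleErr, swapBy]
  rw [← mul_sub, ← Finset.sum_sub_distrib]
  congr 1
  refine Finset.sum_congr rfl fun i _ => ?_
  cases σ i <;> simp [sign]

/-- The value bounding the mean deviation between two samples of size `m` for a hypothesis space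
of VC dimension `d`, depending on a free parameter `t`. -/
def devBound (d m : ℕ) (t : ℝ) : ℝ :=
  (Real.log (2 * ((d + 1) * (2 * m + 1) ^ d)) + t ^ 2 / 2 * m + 1) / t / m

/-- With both samples fixed, a swap only changes signs in the loss differences, and these depend on
`h` only through its trace on the sampled points. Massart's lemma thus applies to a class of
polynomial size. -/
lemma sum_devV_swapBy_le {H : Set (X → Bool)} {d : ℕ} (hd : vcDim H = d)
    (hH : H.Nonempty) (hm : 0 < m) (p : (Fin m → X × Bool) × (Fin m → X × Bool))
    {t : ℝ} (ht : 0 < t) :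
    ∑ σ, devV H m (swapBy σ p) ≤ 2 ^ m * devBound d m t := by
  classical
  have hm' : (0 : ℝ) < m := by exact_mod_cast hm
  set A : Finset X := Finset.univ.image (fun i => (p.1 i).1) ∪ Finset.univ.image fun i => (p.2 i).1
    with hA
  have hAcard : A.card ≤ 2 * m := by
    refine (Finset.card_union_le _ _).trans ?_
    have h1 := Finset.card_image_le (s := (Finset.univ : Finset (Fin m))) (f := fun i => (p.1 i).1)
    have h2 := Finset.card_image_le (s := (Finset.univ : Finset (Fin m))) (f := fun i => (p.2 i).1)
    simp only [Finset.card_univ, Fintype.card_fin] at h1 h2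
    omega
  set S : Finset (Finset X) :=
    A.powerset.filter fun t => ∃ h ∈ H, t = A.filter fun x => h x = true with hS
  have hScard : S.card ≤ (d + 1) * (2 * m + 1) ^ d :=
    (card_traces_le hd A S fun t ht => (Finset.mem_filter.1 ht).2).trans (by gcongr)
  -- The membership indicator of a trace stands in for any hypothesis with that trace: both agree on
  -- `A`.
  set g : Finset X → Fin m → ℝ := fun t i =>
    loss (fun x => decide (x ∈ t)) (p.2 i) - loss (fun x => decide (x ∈ t)) (p.1 i) with hg
  have hgh : ∀ h : X → Bool, ∀ i,
      g (A.filter fun x => h x = true) i = loss h (p.2 i) - loss h (p.1 i) := by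
    intro h i
    have h1 : (p.1 i).1 ∈ A :=
      Finset.mem_union_left _ (Finset.mem_image_of_mem _ (Finset.mem_univ i))
    have h2 : (p.2 i).1 ∈ A :=
      Finset.mem_union_right _ (Finset.mem_image_of_mem _ (Finset.mem_univ i))
    simp [hg, loss_eq_ite, h1, h2]
  have key := sum_le_of_forall_abs_signed_sum_le (S.image g) (fun a ha i => by
      obtain ⟨t, -, rfl⟩ := Finset.mem_image.1 ha
      rw [abs_le]
      constructor <;>
        linarith [loss_nonneg (fun x => decide (x ∈ t)) (p.2 i),
          loss_le_one (fun x => decide (x ∈ t)) (p.2 i),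
          loss_nonneg (fun x => decide (x ∈ t)) (p.1 i),
          loss_le_one (fun x => decide (x ∈ t)) (p.1 i)])
    (N := (d + 1) * (2 * m + 1) ^ d) (by positivity)
    (by exact_mod_cast Finset.card_image_le.trans hScard)
    (fun σ => m * devV H m (swapBy σ p)) (fun σ B hB => by
      have : Nonempty H := hH.to_subtype
      have hle : devV H m (swapBy σ p) ≤ B / m := by
        refine ciSup_le fun h => ?_
        have hmem : (A.filter fun x => (h : X → Bool) x = true) ∈ S := Finset.mem_filter.2
          ⟨Finset.mem_powerset.2 (Finset.filter_subset _ _), h, h.2, rfl⟩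
        have hb := hB _ (Finset.mem_image_of_mem g hmem)
        simp only [hgh] at hb
        rw [sampleErr_swapBy_sub, abs_mul, abs_of_pos (by positivity), one_div_mul_eq_div]
        gcongr
      rw [le_div_iff₀ hm'] at hle
      linarith) ht
  rw [← Finset.mul_sum, Fintype.card_fin] at key
  rw [devBound, ← mul_div_assoc, le_div_iff₀ hm', mul_comm]
  exact key

variable [MeasurableSpace (X × Bool)]

lemma integrable_devV (D : ProbabilityMeasure (X × Bool)) {H : Set (X → Bool)}
    (hV : Measurable (devV H m)) :
    Integrable (devV H m) ((sampleLaw D m).prod (sampleLaw D m)) :=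
  Integrable.of_bound hV.aestronglyMeasurable 1 <| .of_forall fun p => by
    rw [Real.norm_of_nonneg (devV_nonneg _ _)]
    exact devV_le_one _ _

/-- All 2^m swaps give the same integral, so the pointwise bound on their sum can be integrated and
divided by 2^m. -/
lemma integral_devV_le (D : ProbabilityMeasure (X × Bool)) {H : Set (X → Bool)} {d : ℕ}
    (hd : vcDim H = d) (hne : H.Nonempty) (hm : 0 < m) (hV : Measurable (devV H m)) {t : ℝ}
    (ht : 0 < t) :
    ∫ p, devV H m p ∂((sampleLaw D m).prod (sampleLaw D m)) ≤ devBound d m t := by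
  have hmp := measurePreserving_swapBy (ι := Fin m) (D : Measure (X × Bool))
  have hint := integrable_devV D hV
  have hint' : ∀ σ, Integrable (fun p => devV H m (swapBy σ p))
      ((sampleLaw D m).prod (sampleLaw D m)) := fun σ =>
    (hmp σ).integrable_comp_of_integrable hint
  have heq : ∀ σ : Fin m → Bool,
      ∫ p, devV H m (swapBy σ p) ∂((sampleLaw D m).prod (sampleLaw D m)) =
        ∫ p, devV H m p ∂((sampleLaw D m).prod (sampleLaw D m)) := fun σ => by
    have := integral_map (μ := (sampleLaw D m).prod (sampleLaw D m)) (hmp σ).measurable.aemeasurable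
      (f := devV H m)
      hV.aestronglyMeasurable
    exact this.symm.trans (congrArg (fun μ => ∫ p, devV H m p ∂μ) (hmp σ).map_eq)
  have hle : ∫ p, ∑ σ, devV H m (swapBy σ p) ∂((sampleLaw D m).prod (sampleLaw D m)) ≤
      2 ^ m * devBound d m t := by
    refine (integral_mono (integrable_finsetSum _ fun σ _ => hint' σ) (integrable_const _)
      fun p => sum_devV_swapBy_le hd hne hm p ht).trans ?_
    simp
  rw [integral_finsetSum _ fun σ _ => hint' σ] at hle
  simp only [heq, Finset.sum_const, Finset.card_univ, nsmul_eq_mul, Fintype.card_fun,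
    Fintype.card_bool, Fintype.card_fin, Nat.cast_pow, Nat.cast_ofNat] at hle
  exact le_of_mul_le_mul_left hle (by positivity)

/-- Ghost sample: the true error is the mean sample error of z', so the absolute value moves inside
the integral, where V dominates uniformly in `h`. -/
lemma devU_le_integral_devV (D : ProbabilityMeasure (X × Bool)) {H : Set (X → Bool)}
    (hH : ∀ h ∈ H, MeasurableSet (graph h)) (hm : 0 < m) (hV : Measurable (devV H m))
    (z : Fin m → X × Bool) :
    devU H m D z ≤ ∫ z', devV H m (z, z') ∂(sampleLaw D m) := by
  refine Real.iSup_le (fun h => ?_) (integral_nonneg fun _ => devV_nonneg _ _)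
  have hg := hH h h.2
  have hi : Integrable (fun z' => sampleErr z' h - sampleErr z h) (sampleLaw D m) :=
    (integrable_sampleErr D hg).sub (integrable_const _)
  have heq : trueErr D h - sampleErr z h =
      ∫ z', (sampleErr z' h - sampleErr z h) ∂(sampleLaw D m) := by
    rw [integral_sub (integrable_sampleErr D hg) (integrable_const _),
      integral_sampleErr D hg hm]
    simp
  rw [heq]
  refine (abs_integral_le_integral_abs).trans (integral_mono hi.abs ?_ fun z' => le_devV (z, z') h)
  exact Integrable.of_bound (hV.comp measurable_prodMk_left).aestronglyMeasurable 1 <|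
    .of_forall fun z' => by
      rw [Real.norm_of_nonneg (devV_nonneg _ _)]
      exact devV_le_one _ _

lemma integral_devU_le (D : ProbabilityMeasure (X × Bool)) {H : Set (X → Bool)} {d : ℕ}
    (hd : vcDim H = d) (hne : H.Nonempty) (hH : ∀ h ∈ H, MeasurableSet (graph h)) (hm : 0 < m)
    (hV : Measurable (devV H m)) {t : ℝ} (ht : 0 < t) :
    ∫ z, devU H m D z ∂(sampleLaw D m) ≤ devBound d m t := by
  refine le_trans ?_ (integral_devV_le D hd hne hm hV ht)
  rw [integral_prod _ (integrable_devV D hV)]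
  exact integral_mono_of_nonneg (.of_forall fun z => devU_nonneg _ _ _)
    (integrable_devV D hV).integral_prod_left
    (.of_forall fun z => devU_le_integral_devV D hH hm hV z)

/-- The logarithm is o(m), so only t/2 survives. A small fixed t therefore suffices, with no need to
optimize t in m. -/
lemma tendsto_devBound (d : ℕ) {t : ℝ} (ht : t ≠ 0) :
    Filter.Tendsto (fun m : ℕ => devBound d m t) Filter.atTop (nhds (t / 2)) := by
  have h0 : Filter.Tendsto (fun m : ℕ => (1 : ℝ) / m) Filter.atTop (nhds 0) :=
    tendsto_one_div_atTop_nhds_zero_nat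
  have hg : Filter.Tendsto (fun m : ℕ => 2 * (m : ℝ) + 1) Filter.atTop Filter.atTop :=
    Filter.tendsto_atTop_add_const_right _ _
      (tendsto_natCast_atTop_atTop.const_mul_atTop (by norm_num))
  have h1 : Filter.Tendsto (fun m : ℕ => Real.log (2 * (m : ℝ) + 1) / (2 * (m : ℝ) + 1))
      Filter.atTop (nhds 0) :=
    Real.isLittleO_log_id_atTop.tendsto_div_nhds_zero.comp hg
  have h2 := ((h0.const_mul (Real.log (2 * (d + 1)) + 1)).add
    ((h1.mul (h0.const_add 2)).const_mul (d : ℝ))).div_const t |>.add_const (t / 2)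
  simp only [mul_zero, zero_mul, add_zero, zero_div, zero_add] at h2
  refine h2.congr' ?_
  filter_upwards [Filter.eventually_gt_atTop 0] with m hm
  have hm' : (m : ℝ) ≠ 0 := by positivity
  have hlog : Real.log (2 * ((d + 1) * (2 * (m : ℝ) + 1) ^ d)) =
      Real.log (2 * (d + 1)) + d * Real.log (2 * (m : ℝ) + 1) := by
    rw [← mul_assoc, Real.log_mul (by positivity) (by positivity), Real.log_pow]
  have h3 : 2 * (m : ℝ) + 1 ≠ 0 := by positivity
  rw [devBound, hlog]
  field_simp
  ring

/-- Finite VC dimension implies uniform convergence. -/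
theorem hasUCP_of_vcDim_lt_top {𝒟 : Set (ProbabilityMeasure (X × Bool))} {H : Set (X → Bool)}
    (hne : H.Nonempty) (hwb : WellBehaved 𝒟 H) (hvc : vcDim H < ⊤) : HasUCP 𝒟 H := by
  obtain ⟨d, hd⟩ := ENat.ne_top_iff_exists.1 hvc.ne
  obtain ⟨hgraph, mH, hV, hU⟩ := hwb
  refine ⟨mH, hU, fun ε hε δ hδ => ?_⟩
  -- With t = δε the bound tends to δε/2, so the mean of U is eventually at most δε; Markov at level
  -- ε then leaves δ.
  have hpos : 0 < δ * ε := mul_pos hδ.1 hε.1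
  obtain ⟨M, hM⟩ := Filter.eventually_atTop.1
    ((tendsto_devBound d hpos.ne').eventually_le_const (half_lt_self hpos))
  refine ⟨max mH M.succPNat, le_max_left _ _, fun m hm D hD => ?_⟩
  have hmH : mH ≤ m := (le_max_left _ _).trans hm
  have hMm : M ≤ m := (Nat.le_succ M).trans ((le_max_right mH M.succPNat).trans hm : _ ≤ m)
  have hint := (integral_devU_le D hd.symm hne hgraph m.pos (hV m hmH) hpos).trans (hM m hMm)
  have hUint : Integrable (devU H m D) (sampleLaw D m) := by
    refine Integrable.of_bound (hU m hmH D hD).aestronglyMeasurable 1 (.of_forall fun z => ?_)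
    rw [Real.norm_of_nonneg (devU_nonneg _ _ _)]
    exact devU_le_one _ _ _
  have hmarkov := mul_meas_ge_le_integral_of_nonneg (.of_forall fun z => devU_nonneg D H z) hUint ε
  have hset : MeasurableSet {z | devU H m D z ≤ ε} :=
    measurableSet_le (hU m hmH D hD) measurable_const
  have hcompl : (sampleLaw D m).real {z | devU H m D z ≤ ε}ᶜ ≤ δ := by
    have hsub : (sampleLaw D m).real {z | devU H m D z ≤ ε}ᶜ ≤
        (sampleLaw D m).real {z | ε ≤ devU H m D z} :=
      measureReal_mono fun z (hz : ¬ devU H m D z ≤ ε) => (not_le.1 hz).le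
    refine hsub.trans (le_of_mul_le_mul_left ?_ hε.1)
    rw [mul_comm ε δ]
    exact hmarkov.trans hint
  rw [measureReal_compl hset, probReal_univ] at hcompl
  linarith

end Symmetrization

/-! ### Discrete uniform distributions as counting -/

section DiscreteUniform

variable {Ω : Type*} [MeasurableSpace Ω]

/-- The discrete uniform distribution on a nonempty finite family of points. -/
def discreteUniform (l : ℕ+) (ω : Fin l → Ω) : ProbabilityMeasure Ω :=
  ⟨∑ j, (1 / ((l : ℕ) : ℝ≥0∞)) • Measure.dirac (ω j), ⟨by
    simp [ENNReal.mul_inv_cancel]⟩⟩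

lemma coe_discreteUniform (l : ℕ+) (ω : Fin l → Ω) :
    (discreteUniform l ω : Measure Ω) = ∑ j, (1 / ((l : ℕ) : ℝ≥0∞)) • Measure.dirac (ω j) := rfl

lemma isDiscreteUniform_discreteUniform (l : ℕ+) (ω : Fin l → Ω) :
    IsDiscreteUniform (discreteUniform l ω) := ⟨l, ω, rfl⟩

lemma discreteUniform_eq_map (l : ℕ+) (ω : Fin l → Ω) :
    (discreteUniform l ω : Measure Ω) = (discreteUniform l id : Measure (Fin l)).map ω := by
  ext s hs
  rw [Measure.map_apply (measurable_of_finite _) hs]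
  simp only [coe_discreteUniform, Measure.finsetSum_apply, Measure.smul_apply, smul_eq_mul,
    Measure.dirac_apply' _ hs, Measure.dirac_apply]
  rfl

open Classical in
-- Sampling points amounts to sampling indices uniformly, and on the finite index space each index
-- tuple has mass 1/l^m.
lemma pi_discreteUniform_real (l : ℕ+) (ω : Fin l → Ω) (m : ℕ) {C : Set (Fin m → Ω)}
    (hC : MeasurableSet C) :
    (Measure.pi fun _ : Fin m => (discreteUniform l ω : Measure Ω)).real C =
      (Finset.univ.filter fun J : Fin m → Fin l => (fun i => ω (J i)) ∈ C).card / (l : ℝ) ^ m := by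
  have hmap : (Measure.pi fun _ : Fin m => (discreteUniform l ω : Measure Ω)) =
      (Measure.pi fun _ : Fin m => (discreteUniform l id : Measure (Fin l))).map
        fun J i => ω (J i) := by
    have : ∀ _ : Fin m, SigmaFinite ((discreteUniform l id : Measure (Fin l)).map ω) := fun _ => by
      rw [← discreteUniform_eq_map]; infer_instance
    rw [Measure.pi_map_pi fun _ => (measurable_of_finite ω).aemeasurable]
    simp_rw [← discreteUniform_eq_map]
  have hsing : ∀ J : Fin m → Fin l,
      (Measure.pi fun _ : Fin m => (discreteUniform l id : Measure (Fin l))).real {J} =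
        1 / (l : ℝ) ^ m := fun J => by
    have hone : ∀ j : Fin l, (discreteUniform l id : Measure (Fin l)) {j} = ((l : ℕ) : ℝ≥0∞)⁻¹ :=
      fun j => by simp [coe_discreteUniform, Set.indicator]
    rw [measureReal_def, Measure.pi_singleton]
    simp [hone]
  rw [hmap, map_measureReal_apply (measurable_of_finite _) hC]
  have hset : ((fun J : Fin m → Fin l => fun i => ω (J i)) ⁻¹' C) =
      ((Finset.univ.filter fun J : Fin m → Fin l => (fun i => ω (J i)) ∈ C : Finset _) :
        Set (Fin m → Fin l)) := by
    ext J; simp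
  rw [hset, ← sum_measureReal_singleton]
  simp only [hsing, Finset.sum_const, nsmul_eq_mul]
  ring

end DiscreteUniform

/-! ### No free lunch: infinite VC dimension defeats every learner -/

section NoFreeLunch

variable {X : Type*}

/-- Averaged over all labellings of `n` points, a hypothesis that does not see the label of the
point `x j` errs there with frequency one half. -/
lemma sum_loss_eq_of_update_invariant {n : ℕ} (x : Fin n → X) (g : (Fin n → Bool) → X → Bool)
    (j : Fin n) (hg : ∀ b, g (Function.update b j (!b j)) = g b) :
    ∑ b : Fin n → Bool, loss (g b) (x j, b j) = 2 ^ n / 2 := by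
  set e : (Fin n → Bool) → Fin n → Bool := fun b => Function.update b j (!b j) with he
  have hinv : Function.Involutive e := fun b => by simp [he]
  have hsum : ∑ b, loss (g (e b)) (x j, e b j) = ∑ b, loss (g b) (x j, b j) :=
    Equiv.sum_comp hinv.toPerm fun b => loss (g b) (x j, b j)
  have hadd : ∀ b, loss (g b) (x j, b j) + loss (g (e b)) (x j, e b j) = 1 := fun b => by
    rw [show g (e b) = g b from hg b]
    simp only [loss_eq_ite, he, Function.update_self]
    cases g b (x j) <;> cases b j <;> simp
  have htot : ∑ b, (loss (g b) (x j, b j) + loss (g (e b)) (x j, e b j)) = 2 ^ n := by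
    simp [hadd]
  rw [Finset.sum_add_distrib, hsum] at htot
  linarith

variable [MeasurableSpace (X × Bool)] [MeasurableSingletonClass (X × Bool)]

/-- Measurable singletons allow Dirac masses to be evaluated even on a graph not known to be
measurable. -/
lemma trueErr_discreteUniform (l : ℕ+) (ω : Fin l → X × Bool) (h : X → Bool) :
    trueErr (discreteUniform l ω) h = 1 / (l : ℝ) * ∑ j, loss h (ω j) := by
  have hdirac : ∀ z : X × Bool, (Measure.dirac z).real (graph h)ᶜ = loss h z := fun z => by
    by_cases hz : z ∈ graph h <;> simp [Measure.real, loss, hz]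
  rw [trueErr, coe_discreteUniform, measureReal_def, Measure.finsetSum_apply,
    ENNReal.toReal_sum (fun j _ => by
      rw [Measure.smul_apply, smul_eq_mul]
      exact ENNReal.mul_ne_top (by simp) (measure_ne_top _ _)), Finset.mul_sum]
  refine Finset.sum_congr rfl fun j _ => ?_
  rw [Measure.smul_apply, smul_eq_mul, ENNReal.toReal_mul, ← measureReal_def, hdirac]
  simp

/-- **No free lunch**: PAC learnability implies finite VC dimension. -/
theorem vcDim_lt_top_of_pacLearnable {𝒟 : Set (ProbabilityMeasure (X × Bool))}
    (h𝒟 : ∀ P, IsDiscreteUniform P → P ∈ 𝒟) {H : Set (X → Bool)} (hpac : PACLearnable 𝒟 H) :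
    vcDim H < ⊤ := by
  classical
  by_contra hvc
  rw [not_lt_top_iff] at hvc
  obtain ⟨A, hA⟩ := hpac
  obtain ⟨m, hm⟩ := hA (1 / 10) (by norm_num) (1 / 10) (by norm_num)
  specialize hm m le_rfl
  set n : ℕ+ := 2 * m with hn
  have hnm : (n : ℕ) = 2 * m := by simp [hn]
  obtain ⟨x, hx⟩ := exists_shattered_family hvc n
  set s : (Fin n → Bool) → (Fin m → Fin n) → Fin m → X × Bool :=
    fun b J i => (x (J i), b (J i)) with hs
  set E : (Fin n → Bool) → (Fin m → Fin n) → ℝ := fun b J =>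
    trueErr (discreteUniform n fun j => (x j, b j)) (A ⟨m, s b J⟩) with hE
  have hn0 : (0 : ℝ) < (n : ℕ) := by exact_mod_cast n.pos
  have hupper : ∀ b, ∑ J, E b J ≤ (n : ℝ) ^ (m : ℕ) * (1 / 5) := by
    intro b
    set ω : Fin n → X × Bool := fun j => (x j, b j) with hω
    obtain ⟨C, hC, hCsub, hCp⟩ := hm _ (h𝒟 _ (isDiscreteUniform_discreteUniform n ω))
    have hopt : trueOpt (discreteUniform n ω) H ≤ 0 := by
      obtain ⟨h, hh, hb⟩ := hx b
      refine (trueOpt_le _ hh).trans ?_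
      simp [trueErr_discreteUniform, loss_eq_ite, hω, hb]
    rw [sampleLaw, pi_discreteUniform_real n ω m hC, le_div_iff₀ (by positivity)] at hCp
    -- The error is at most 1/10 on `C` and 1 elsewhere. As `C` has mass at least 9/10, averaging
    -- gives 11/10 - 9/10 = 1/5.
    have hbound : ∀ J : Fin m → Fin n,
        E b J ≤ 11 / 10 - if (fun i => ω (J i)) ∈ C then 1 else 0 := by
      intro J
      split_ifs with hJ
      · have : trueErr (discreteUniform n ω) (A ⟨m, s b J⟩) - trueOpt (discreteUniform n ω) H ≤
          1 / 10 := hCsub hJ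
        have : E b J ≤ 1 / 10 := by linarith
        linarith
      · have : E b J ≤ 1 := trueErr_le_one _ _
        linarith
    refine (Finset.sum_le_sum fun J _ => hbound J).trans ?_
    rw [Finset.sum_sub_distrib, Finset.sum_const, Finset.sum_boole, Finset.card_univ,
      Fintype.card_fun, Fintype.card_fin, Fintype.card_fin, nsmul_eq_mul, Nat.cast_pow]
    linarith
  -- At least m of the 2m points are unseen, each contributing mean loss 1/2.
  have hlower : ∀ J, 2 ^ (n : ℕ) / 4 ≤ ∑ b, E b J := by
    intro J
    have hunseen : (m : ℕ) ≤ (Finset.univ.image J)ᶜ.card := by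
      have h1 := Finset.card_image_le (s := (Finset.univ : Finset (Fin m))) (f := J)
      rw [Finset.card_univ, Fintype.card_fin] at h1
      rw [Finset.card_compl, Fintype.card_fin]
      omega
    have hpt : ∀ j ∈ (Finset.univ.image J)ᶜ,
        ∑ b : Fin n → Bool, loss (A ⟨m, s b J⟩ : X → Bool) (x j, b j) = 2 ^ (n : ℕ) / 2 := by
      intro j hj
      refine sum_loss_eq_of_update_invariant x (fun b => (A ⟨m, s b J⟩ : X → Bool)) j fun b => ?_
      have hsb : s (Function.update b j (!b j)) J = s b J := by
        funext i
        have hne : J i ≠ j := fun h => by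
          simp only [Finset.mem_compl, Finset.mem_image, Finset.mem_univ, true_and] at hj
          exact hj ⟨i, h⟩
        simp [hs, Function.update_of_ne hne]
      simp only [hsb]
    have hsum : ∑ b, E b J = 1 / (n : ℝ) * ∑ j,
        ∑ b : Fin n → Bool, loss (A ⟨m, s b J⟩ : X → Bool) (x j, b j) := by
      simp only [hE, trueErr_discreteUniform]
      rw [← Finset.mul_sum, Finset.sum_comm]
    have hge : (m : ℝ) * (2 ^ (n : ℕ) / 2) ≤
        ∑ j, ∑ b : Fin n → Bool, loss (A ⟨m, s b J⟩ : X → Bool) (x j, b j) := by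
      calc (m : ℝ) * (2 ^ (n : ℕ) / 2)
          ≤ ((Finset.univ.image J)ᶜ.card : ℝ) * (2 ^ (n : ℕ) / 2) := by
            gcongr
        _ = ∑ j ∈ (Finset.univ.image J)ᶜ,
              ∑ b : Fin n → Bool, loss (A ⟨m, s b J⟩ : X → Bool) (x j, b j) := by
            rw [Finset.sum_congr rfl hpt, Finset.sum_const, nsmul_eq_mul]
        _ ≤ _ := Finset.sum_le_sum_of_subset_of_nonneg (Finset.subset_univ _)
            fun j _ _ => Finset.sum_nonneg fun b _ => loss_nonneg _ _
    have hnm' : ((n : ℕ) : ℝ) = 2 * (m : ℕ) := by exact_mod_cast hnm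
    rw [hsum, one_div_mul_eq_div, le_div_iff₀ hn0, hnm']
    linarith
  -- Summing `E` over labellings and index tuples in both orders would force 1/4 ≤ 1/5.
  have h1 := Finset.sum_le_sum fun b (_ : b ∈ Finset.univ) => hupper b
  have h2 := Finset.sum_le_sum fun J (_ : J ∈ Finset.univ) => hlower J
  rw [Finset.sum_comm] at h2
  have h3 := h2.trans h1
  simp only [Finset.sum_const, Finset.card_univ, Fintype.card_fun, Fintype.card_fin,
    Fintype.card_bool, nsmul_eq_mul, Nat.cast_pow, Nat.cast_ofNat] at h3
  have hpos : (0 : ℝ) < (n : ℝ) ^ (m : ℕ) * 2 ^ (n : ℕ) := by positivity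
  linarith

end NoFreeLunch

/-! ### Near-minimizers of the sample error -/

section Learning

variable {X : Type*}

lemma exists_isNMSE {H : Set (X → Bool)} (hH : H.Nonempty) :
    ∃ A : LearningFunction H, IsNMSE A := by
  have : Nonempty H := hH.to_subtype
  have hex : ∀ s : Σ m : ℕ+, (Fin m → X × Bool),
      ∃ h : H, sampleErr s.2 (h : X → Bool) < sampleOpt s.2 H + 1 / (s.1 : ℝ) := fun s =>
    exists_lt_of_ciInf_lt (lt_add_of_pos_right _ (one_div_pos.2 (by exact_mod_cast s.1.pos)))
  choose A hA using hex
  refine ⟨A, fun ε hε => ?_⟩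
  obtain ⟨k, hk⟩ := exists_nat_one_div_lt hε.1
  refine ⟨k.succPNat, fun m hm z => ?_⟩
  have h1 := hA ⟨m, z⟩
  have hkm : ((k : ℝ) + 1) ≤ ((m : ℕ) : ℝ) := by exact_mod_cast (hm : (k.succPNat : ℕ) ≤ m)
  have h2 : 1 / ((m : ℕ) : ℝ) ≤ 1 / ((k : ℝ) + 1) := by gcongr
  dsimp only at h1
  linarith

variable [MeasurableSpace (X × Bool)]

/-- Passing between true and sample error costs ε twice: once for `h`, once for the competitors in
the infimum. -/
lemma trueErr_sub_trueOpt_le {H : Set (X → Bool)} (hH : H.Nonempty)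
    (D : ProbabilityMeasure (X × Bool)) {m : ℕ} {z : Fin m → X × Bool} {h : X → Bool} (hh : h ∈ H)
    {ε η : ℝ} (hU : devU H m D z ≤ ε) (hη : sampleErr z h - sampleOpt z H ≤ η) :
    trueErr D h - trueOpt D H ≤ 2 * ε + η := by
  have : Nonempty H := hH.to_subtype
  have h1 := (abs_le.1 ((le_devU D z hh).trans hU)).2
  have h2 : sampleOpt z H - ε ≤ trueOpt D H := le_ciInf fun g => by
    have h3 := (abs_le.1 ((le_devU D z g.2).trans hU)).1
    linarith [sampleOpt_le z g.2]
  linarith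

/-- Under uniform convergence, nearly minimizing the sample error is PAC. -/
theorem HasUCP.isPAC_of_isNMSE {𝒟 : Set (ProbabilityMeasure (X × Bool))} {H : Set (X → Bool)}
    (hH : H.Nonempty) (hucp : HasUCP 𝒟 H) {A : LearningFunction H} (hA : IsNMSE A) :
    IsPAC 𝒟 A := by
  obtain ⟨mH, hU, hconv⟩ := hucp
  intro ε hε δ hδ
  have hε3 : ε / 3 ∈ Set.Ioo (0 : ℝ) 1 := ⟨by linarith [hε.1], by linarith [hε.1, hε.2]⟩
  obtain ⟨m₁, hmH, hm₁⟩ := hconv (ε / 3) hε3 δ hδ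
  obtain ⟨m₂, hm₂⟩ := hA (ε / 3) hε3
  refine ⟨max m₁ m₂, fun m hm D hD => ?_⟩
  have hle₁ := (le_max_left m₁ m₂).trans hm
  refine ⟨{z | devU H m D z ≤ ε / 3},
    measurableSet_le (hU m (hmH.trans hle₁) D hD) measurable_const, fun z hz => ?_,
    hm₁ m hle₁ D hD⟩
  have := trueErr_sub_trueOpt_le hH D (A ⟨m, z⟩).2 hz (hm₂ m ((le_max_right m₁ m₂).trans hm) z)
  exact this.trans (by linarith)

end Learning

end StatLearning

end

theorem mainTheorem2 {X : Type*} [Nonempty X]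
    [MeasurableSpace (X × Bool)] [MeasurableSingletonClass (X × Bool)]
    (𝒟 : Set (MeasureTheory.ProbabilityMeasure (X × Bool)))
    (h𝒟 : ∀ P : MeasureTheory.ProbabilityMeasure (X × Bool),
      StatLearning.IsDiscreteUniform P → P ∈ 𝒟)
    (H : Set (X → Bool)) (hH : H.Nonempty) (hwb : StatLearning.WellBehaved 𝒟 H) :
    List.TFAE [
      StatLearning.vcDim H < ⊤,
      StatLearning.HasUCP 𝒟 H,
      ∀ A : StatLearning.LearningFunction H, StatLearning.IsNMSE A → StatLearning.IsPAC 𝒟 A,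
      StatLearning.PACLearnable 𝒟 H] ∧
    (StatLearning.PACLearnable 𝒟 H ↔ StatLearning.vcDim H < ⊤) := by
  have tfae : List.TFAE [
      StatLearning.vcDim H < ⊤,
      StatLearning.HasUCP 𝒟 H,
      ∀ A : StatLearning.LearningFunction H, StatLearning.IsNMSE A → StatLearning.IsPAC 𝒟 A,
      StatLearning.PACLearnable 𝒟 H] := by
    tfae_have 1 → 2 := StatLearning.hasUCP_of_vcDim_lt_top hH hwb
    tfae_have 2 → 3 := fun h _ hA => h.isPAC_of_isNMSE hH hA
    tfae_have 3 → 4 := fun h =>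
      (StatLearning.exists_isNMSE hH).imp fun A hA => h A hA
    tfae_have 4 → 1 := StatLearning.vcDim_lt_top_of_pacLearnable h𝒟
    tfae_finish
  exact ⟨tfae, tfae.out 3 0⟩
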